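/- Let $A$ be a finite alphabet, $p\ge 2$, and let $\tau:A\to A^{p}$ be a substitution of constant length $p$, extended by concatenation to finite words and to two-sided sequences (so that $\tau(x)$ has the word $\tau(x_m)$ on the coordinates $pm,\dots,pm+p-1$). Assume that $\tau$ is primitive: for some $n$, every $a\in A$ appears in $\tau^n(b)$ for every $b\in A$. Let $X_\tau\subseteq A^{\mathbb Z}$ be the subshift generated by $\tau$, that is, the set of all two-sided sequences whose finite subwords all occur in words $\tau^n(a)$, $n\ge 0$, $a\in A$, with the topology induced by the product topology; let $T$ be the shift $(Tx)_i=x_{i+1}$, and assume that $X_\tau$ is infinite. Let $\mathcal O_p=\varprojlim_k \mathbb Z/p^k\mathbb Z$ be the $p$-odometer, with $T_0z=z+1$. Then for every $x\in X_\tau$ there are a unique sequence $(x^{(i)})_{i\ge 0}$ in $X_\tau$ and a unique sequence $(\delta_i)_{i\ge 0}$ in $\{0,\dots,p-1\}$ such that $x^{(0)}=x$ and $\tau(x^{(i+1)})=T^{-\delta_i}(x^{(i)})$ for all $i\ge 0$. The map $\pi:X_\tau\to\mathcal O_p$, $\pi(x)=\sum_{i\ge 0}\delta_i p^i$, is a factor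 map from $(X_\tau,T)$ onto $(\mathcal O_p,T_0)$, that is, it is continuous and surjective, and $\pi\circ T=T_0\circ\pi$. For every $z\in\mathcal O_p$ the fibre $\pi^{-1}(\{z\})$ is finite and has fewer than $K$ points, where $K$ is the number of words of length $3$ that occur in points of $X_\tau$. Consequently, all scrambled sets of $(X_\tau,T)$ are finite: if $\varrho$ is a metric that induces the topology of $X_\tau$, and $S\subseteq X_\tau$ is such that $$\limsup_{n\to\infty}\varrho(T^nx,T^ny)>0\quad\text{and}\quad \liminf_{n\to\infty}\varrho(T^nx,T^ny)=0$$ for any two distinct points $x,y\in S$, then $S$ is finite. -/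

import Mathlib

open Filter Topology

namespace ConstLength

/-! Throughout, `A` is the alphabet and a substitution of constant length `p` is a map
`τ : A → Fin p → A`, the word `τ a` being `τ a 0, …, τ a (p - 1)`. -/

section Substitution

variable {A : Type*} {p : ℕ}

/-- The extension of `τ` to finite words, by concatenation. -/
def onWord (τ : A → Fin p → A) (w : List A) : List A :=
  w.flatMap fun a => List.ofFn (τ a)

/-- The word `τ ^ n (a)`. -/
def iterWord (τ : A → Fin p → A) (n : ℕ) (a : A) : List A :=
  (onWord τ)^[n] [a]

/-- `τ` is primitive: for some `n`, every letter appears in `τ ^ n (b)` for every letter `b`. -/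
def IsPrimitive (τ : A → Fin p → A) : Prop :=
  ∃ n : ℕ, ∀ a b : A, a ∈ iterWord τ n b

/-- The extension of `τ` to two-sided sequences: coordinates `p * m, …, p * m + p - 1` of the
image form the word `τ (x m)`. -/
def onSeq [NeZero p] (τ : A → Fin p → A) (x : ℤ → A) : ℤ → A :=
  fun i => τ (x (i / (p : ℤ))) (Fin.ofNat p (i % (p : ℤ)).toNat)

/-- The power `T ^ k` of the shift map, `k ∈ ℤ`; the shift map `T` itself is the case `k = 1`. -/
def shiftBy (k : ℤ) (x : ℤ → A) : ℤ → A :=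
  fun i => x (i + k)

/-- The word of length `n` of `x` that starts at coordinate `i`. -/
def subword (x : ℤ → A) (i : ℤ) (n : ℕ) : List A :=
  List.ofFn fun j : Fin n => x (i + (j : ℕ))

/-- The subshift `X_τ`: all two-sided sequences each of whose finite words occurs in some word
`τ ^ n (a)`. Any closed set `Y` with `T Y = Y` in which all words `τ ^ n (a)` appear contains it, and
for primitive `τ` of length at least two it is the smallest such set. -/
def subshift (τ : A → Fin p → A) : Set (ℤ → A) :=
  {x | ∀ (i : ℤ) (l : ℕ), ∃ (n : ℕ) (a : A), subword x i l <:+: iterWord τ n a}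

theorem shiftBy_mem (τ : A → Fin p → A) (k : ℤ) {x : ℤ → A} (hx : x ∈ subshift τ) :
    shiftBy k x ∈ subshift τ := by
  intro i l
  obtain ⟨n, a, h⟩ := hx (i + k) l
  refine ⟨n, a, ?_⟩
  have e : subword (shiftBy k x) i l = subword x (i + k) l := by
    unfold subword shiftBy
    congr 1
    funext j
    congr 1
    ring
  rw [e]
  exact h

/-- The shift map `T` on `X_τ`. -/
def shift (τ : A → Fin p → A) (x : subshift τ) : subshift τ :=
  ⟨shiftBy 1 x.1, shiftBy_mem τ 1 x.2⟩

/-- The set of words of length `l` of `X_τ`. -/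
def wordsOfLength (τ : A → Fin p → A) (l : ℕ) : Set (List A) :=
  {w | ∃ x ∈ subshift τ, ∃ i : ℤ, w = subword x i l}

end Substitution

section Odometer

/-- The `p`-odometer as a topological ring: the inverse limit of the (discrete) rings
`ℤ / p ^ k ℤ`, `k ∈ ℕ`, under the reduction maps. Its topology is the one induced by the product
of the discrete topologies of the `ZMod (p ^ k)`. -/
def odometer (p : ℕ) : Subring (∀ k : ℕ, ZMod (p ^ k)) where
  carrier := {f | ∀ k : ℕ,
    ZMod.castHom (pow_dvd_pow p k.le_succ) (ZMod (p ^ k)) (f (k + 1)) = f k}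
  mul_mem' := fun {a b} ha hb k => by rw [Pi.mul_apply, map_mul, ha k, hb k, Pi.mul_apply]
  one_mem' := fun k => by rw [Pi.one_apply, map_one, Pi.one_apply]
  add_mem' := fun {a b} ha hb k => by rw [Pi.add_apply, map_add, ha k, hb k, Pi.add_apply]
  zero_mem' := fun k => by rw [Pi.zero_apply, map_zero, Pi.zero_apply]
  neg_mem' := fun {a} ha k => by rw [Pi.neg_apply, map_neg, ha k, Pi.neg_apply]

/-- The translation `T₀ z = z + 1` of the odometer. -/
def addOne (p : ℕ) (z : odometer p) : odometer p :=
  z + 1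

/-- The point `∑ i, δ i * p ^ i` of the odometer whose base `p` expansion is `δ`. -/
def ofDigits {p : ℕ} (δ : ℕ → Fin p) : odometer p :=
  ⟨fun k => ∑ i ∈ Finset.range k, ((δ i : ℕ) : ZMod (p ^ k)) * (p : ZMod (p ^ k)) ^ i, by
    intro k
    have h : (p : ZMod (p ^ k)) ^ k = 0 := by
      rw [← Nat.cast_pow]
      exact ZMod.natCast_self _
    simp only [map_sum, map_mul, map_pow, map_natCast]
    rw [Finset.sum_range_succ, h, mul_zero, add_zero]⟩

end Odometer

section FactorMap

variable {A : Type*} {p : ℕ} [NeZero p]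

/-- The points `y 0, y 1, …` of `X_τ` and the digits `δ` desubstitute `x`: `y 0 = x` and
`τ (y (i + 1)) = T ^ (- δ i) (y i)` for all `i`. -/
def Desubstitutes (τ : A → Fin p → A) (x : subshift τ) (y : ℕ → subshift τ)
    (δ : ℕ → Fin p) : Prop :=
  y 0 = x ∧ ∀ i : ℕ, onSeq τ (y (i + 1)).1 = shiftBy (-((δ i : ℕ) : ℤ)) (y i).1

open Classical in
/-- The map `π : X_τ → O_p` sending `x` to the point with expansion `δ`, where `δ` is the digit
sequence that desubstitutes `x`. (Existence and uniqueness of `δ` are theorems for primitive `τ`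
with infinite `X_τ`; the value `0` is a default that is then never used.) -/
noncomputable def toOdometer (τ : A → Fin p → A) (x : subshift τ) : odometer p :=
  if h : ∃ q : (ℕ → subshift τ) × (ℕ → Fin p), Desubstitutes τ x q.1 q.2 then
    ofDigits h.choose.2
  else 0

end FactorMap

section Dynamics

/-- `f` is a factor map from the system `(X, T)` onto the system `(Y, S)`. -/
def IsFactorMap {X Y : Type*} [TopologicalSpace X] [TopologicalSpace Y]
    (T : X → X) (S : Y → Y) (f : X → Y) : Prop :=
  Continuous f ∧ Function.Surjective f ∧ ∀ x, f (T x) = S (f x)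

/-- Li–Yorke pairs of a self-map of a compact metric space. -/
def IsLiYorkePair {X : Type*} [MetricSpace X] (T : X → X) (x y : X) : Prop :=
  0 < limsup (fun n : ℕ => dist (T^[n] x) (T^[n] y)) atTop ∧
    liminf (fun n : ℕ => dist (T^[n] x) (T^[n] y)) atTop = 0

/-- Scrambled sets: any two distinct points form a Li–Yorke pair. -/
def IsScrambled {X : Type*} [MetricSpace X] (T : X → X) (S : Set X) : Prop :=
  ∀ x ∈ S, ∀ y ∈ S, x ≠ y → IsLiYorkePair T x y

end Dynamics

end ConstLength

namespace ConstLength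

/-! ### Words, blocks and the action of the substitution on sequences. -/

section Words

variable {A : Type*} {p : ℕ}

/-! Write X for `subshift τ`. Everything is read off from the sets T^i τ^k(X), called `level`.
Primitivity makes X minimal, so each level is minimal for T^(p^k), two levels of the same order are
equal or disjoint, and they recur in i with a period c_k dividing p^k. The heart is c_k = p^k, in
the form `pow_dvd_sub_of_mem_level`. If c_k were too small against p^k, a pigeonhole argument would
give all points a common period and make X finite (`finite_of_factorial_mul_le`). So p^k / c_k is
bounded; being nondecreasing, it is eventually constant. Hence p^k divides some c_m with m ≥ k, and
this descends to order k because the sets T^(p^k l) τ^m(X) cover τ^k(X).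

The offset i of a point of T^i τ^k(X) is thus unique modulo p^k: it is the k-th coordinate of π.
With injectivity of τ on X (`injOn_onSeq`) this gives unique desubstitution; compactness of the
levels gives continuity and surjectivity of π.

A fibre of π fixes the block boundaries of every order, and each window is covered by two
consecutive blocks of some order. So a fibre has at most as many points as there are words of length
2, which are fewer than those of length 3 since X is infinite. Finally, a Li–Yorke pair comes
arbitrarily close, while the odometer coordinates of its points keep a constant difference; so it
lies in one fibre. -/

theorem iterate_onWord_append (τ : A → Fin p → A) (n : ℕ) (u v : List A) :
    (onWord τ)^[n] (u ++ v) = (onWord τ)^[n] u ++ (onWord τ)^[n] v := by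
  induction n generalizing u v with
  | zero => rfl
  | succ n ih =>
    simp only [Function.iterate_succ, Function.comp_apply]
    rw [← ih]
    simp [onWord]

theorem length_onWord (τ : A → Fin p → A) (w : List A) :
    (onWord τ w).length = p * w.length := by
  induction w with
  | nil => simp [onWord]
  | cons a w ih =>
    simp only [onWord, List.flatMap_cons, List.length_append, List.length_ofFn,
      List.length_cons] at ih ⊢
    rw [ih]
    ring

theorem length_iterate_onWord (τ : A → Fin p → A) (n : ℕ) (w : List A) :
    ((onWord τ)^[n] w).length = p ^ n * w.length := by
  induction n with
  | zero => simp
  | succ n ih =>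
    rw [Function.iterate_succ_apply', length_onWord, ih]
    ring

theorem length_iterWord (τ : A → Fin p → A) (n : ℕ) (a : A) :
    (iterWord τ n a).length = p ^ n := by
  simp [iterWord, length_iterate_onWord]

theorem iterWord_add (τ : A → Fin p → A) (m n : ℕ) (a : A) :
    iterWord τ (m + n) a = (onWord τ)^[m] (iterWord τ n a) := by
  rw [iterWord, Function.iterate_add_apply, iterWord]

theorem iterate_onWord_infix (τ : A → Fin p → A) (n : ℕ) {u v : List A} (h : u <:+: v) :
    (onWord τ)^[n] u <:+: (onWord τ)^[n] v := by
  obtain ⟨s, t, rfl⟩ := h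
  exact ⟨(onWord τ)^[n] s, (onWord τ)^[n] t, by simp only [iterate_onWord_append]⟩

/-- A long enough factor of a word `τ ^ n (w)` contains the image of a letter. -/
theorem exists_iterWord_infix (τ : A → Fin p → A) (n : ℕ) (w s u t : List A)
    (h : s ++ u ++ t = (onWord τ)^[n] w) (hu : 2 * p ^ n ≤ u.length) (hw : 0 < u.length) :
    ∃ b, iterWord τ n b <:+: u := by
  induction w generalizing s with
  | nil =>
    have := congrArg List.length h
    rw [length_iterate_onWord] at this
    simp at this
    simp [this] at hw
  | cons b w ih =>
    have hb : (onWord τ)^[n] (b :: w) = iterWord τ n b ++ (onWord τ)^[n] w := by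
      rw [← List.singleton_append, iterate_onWord_append, iterWord]
    have hlb := length_iterWord τ n b
    rw [hb, List.append_assoc, List.append_eq_append_iff] at h
    rcases h with ⟨v, hv, hv'⟩ | ⟨v, rfl, hv'⟩
    · -- the factor starts inside the image of the first letter
      cases w with
      | nil =>
        have h1 := congrArg List.length hv'
        have h2 := congrArg List.length hv
        rw [List.length_append, List.length_append, length_iterate_onWord] at h1
        rw [List.length_append] at h2
        simp at h1
        omega
      | cons c w =>
        have hc : (onWord τ)^[n] (c :: w) = iterWord τ n c ++ (onWord τ)^[n] w := by
          rw [← List.singleton_append, iterate_onWord_append, iterWord]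
        have hlc := length_iterWord τ n c
        have h2 := congrArg List.length hv
        rw [List.length_append] at h2
        rw [hc, ← List.append_assoc, List.append_eq_append_iff] at hv'
        -- The rest `v` of the first block and the whole next block have total length at most `2 * p
        -- ^ n`, so the next block lies inside `u`.
        refine ⟨c, ?_⟩
        rcases hv' with ⟨q, hq, -⟩ | ⟨q, hq, -⟩
        · have h3 := congrArg List.length hq
          simp only [List.length_append] at h3
          have : q = [] := List.eq_nil_of_length_eq_zero (by omega)
          subst this
          rw [List.append_nil] at hq
          exact ⟨v, [], by simp [hq]⟩
        · exact ⟨v, q, hq.symm⟩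
    · exact ih v (by rw [List.append_assoc]; exact hv'.symm)

theorem subword_eq_iff {x y : ℤ → A} {i j : ℤ} {l : ℕ} :
    subword x i l = subword y j l ↔ ∀ k : ℕ, k < l → x (i + k) = y (j + k) := by
  rw [subword, subword, List.ofFn_injective.eq_iff, funext_iff]
  exact ⟨fun h k hk => h ⟨k, hk⟩, fun h k => h k k.2⟩

theorem length_subword (x : ℤ → A) (i : ℤ) (l : ℕ) : (subword x i l).length = l := by
  simp [subword]

theorem subword_add (x : ℤ → A) (i : ℤ) (l m : ℕ) :
    subword x i (l + m) = subword x i l ++ subword x (i + l) m := by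
  simp only [subword, List.ofFn_add]
  congr 1
  simp [add_assoc]

theorem subword_infix (x : ℤ → A) {i j : ℤ} {l m : ℕ} (h : j ≤ i) (h' : i + l ≤ j + m) :
    subword x i l <:+: subword x j m := by
  obtain ⟨s, rfl⟩ := Int.le.dest h
  obtain ⟨t, rfl⟩ : ∃ t, m = s + l + t := ⟨m - (s + l), by omega⟩
  exact ⟨subword x j s, subword x (j + (s + l : ℕ)) t, by rw [subword_add, subword_add]⟩

theorem eq_subword_of_infix {x : ℤ → A} {i : ℤ} {l : ℕ} {u : List A} (h : u <:+: subword x i l) :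
    ∃ j, u = subword x j u.length := by
  obtain ⟨s, t, h⟩ := h
  have hl := congrArg List.length h
  simp only [length_subword, List.length_append] at hl
  rw [← hl, subword_add, subword_add] at h
  have h1 := List.append_inj_left h (by simp [length_subword])
  exact ⟨_, List.append_inj_right h1 (by simp [length_subword])⟩

theorem shiftBy_shiftBy (k l : ℤ) (x : ℤ → A) : shiftBy k (shiftBy l x) = shiftBy (k + l) x :=
  funext fun i => congrArg x (by ring)

theorem shiftBy_zero (x : ℤ → A) : shiftBy 0 x = x :=
  funext fun i => congrArg x (by ring)

/-- Every word of the language of a primitive substitution occurs in every point. -/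
theorem exists_subword_eq {τ : A → Fin p → A} (hp : 2 ≤ p) (hprim : IsPrimitive τ) {x f : ℤ → A}
    (hx : x ∈ subshift τ) (hf : f ∈ subshift τ) (i : ℤ) (l : ℕ) :
    ∃ j, subword f j l = subword x i l := by
  obtain ⟨N, hN⟩ := hprim
  obtain ⟨n, a, hxa⟩ := hx i l
  -- A window this long contains a block τ^n(τ^N(b)), and τ^N(b) contains the letter `a`.
  obtain ⟨m, c, hm⟩ := hf 0 (2 * p ^ (n + N))
  have hpos : 0 < p ^ (n + N) := Nat.pow_pos (by omega)
  have hle : n + N ≤ m := by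
    have := hm.length_le
    rw [length_subword, length_iterWord] at this
    exact ((Nat.pow_lt_pow_iff_right (by omega : 1 < p)).1 (by omega)).le
  obtain ⟨k, rfl⟩ := Nat.exists_eq_add_of_le hle
  rw [iterWord_add] at hm
  obtain ⟨s, t, hst⟩ := hm
  obtain ⟨b, hb⟩ := exists_iterWord_infix τ (n + N) _ s _ t hst (by rw [length_subword])
    (by rw [length_subword]; omega)
  rw [iterWord_add] at hb
  have hab : [a] <:+: iterWord τ N b := List.singleton_infix_iff _ _ |>.2 (hN a b)
  obtain ⟨j, hj⟩ := eq_subword_of_infix (hxa.trans ((iterate_onWord_infix τ n hab).trans hb))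
  rw [length_subword] at hj
  exact ⟨j, hj.symm⟩

variable [NeZero p]

theorem subword_onSeq (τ : A → Fin p → A) (x : ℤ → A) (i : ℤ) (l : ℕ) :
    subword (onSeq τ x) (p * i) (p * l) = onWord τ (subword x i l) := by
  have hp : (p : ℤ) ≠ 0 := Nat.cast_ne_zero.2 (NeZero.ne p)
  have block : ∀ i : ℤ, subword (onSeq τ x) (p * i) p = List.ofFn (τ (x i)) := by
    intro i
    rw [subword]
    congr 1
    funext j
    have h1 : (p * i + (j : ℕ)) / (p : ℤ) = i := by
      rw [add_comm, Int.add_mul_ediv_left _ _ hp, Int.ediv_eq_zero_of_lt (by positivity)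
        (by exact_mod_cast j.2), zero_add]
    have h2 : (p * i + (j : ℕ)) % (p : ℤ) = (j : ℕ) := by
      rw [add_comm, Int.add_mul_emod_self_left, Int.emod_eq_of_lt (by positivity)
        (by exact_mod_cast j.2)]
    simp only [onSeq, h1, h2, Int.toNat_natCast]
    congr 1
    ext
    simp
  induction l with
  | zero => simp [subword, onWord]
  | succ l ih =>
    rw [Nat.mul_succ, subword_add, ih, subword_add]
    have : (p * i + (p * l : ℕ) : ℤ) = p * (i + l) := by push_cast; ring
    rw [this, block]
    simp [onWord, subword]

theorem subword_iterate_onSeq (τ : A → Fin p → A) (n : ℕ) (x : ℤ → A) (i : ℤ) (l : ℕ) :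
    subword ((onSeq τ)^[n] x) (p ^ n * i) (p ^ n * l) = (onWord τ)^[n] (subword x i l) := by
  induction n with
  | zero => simp
  | succ n ih =>
    rw [Function.iterate_succ_apply', Function.iterate_succ_apply', ← ih, ← subword_onSeq]
    congr 1 <;> ring

theorem subword_iterate_onSeq_letter (τ : A → Fin p → A) (n : ℕ) (x : ℤ → A) (i : ℤ) :
    subword ((onSeq τ)^[n] x) (p ^ n * i) (p ^ n) = iterWord τ n (x i) := by
  simpa [subword, iterWord] using subword_iterate_onSeq τ n x i 1

theorem onSeq_shiftBy (τ : A → Fin p → A) (k : ℤ) (x : ℤ → A) :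
    onSeq τ (shiftBy k x) = shiftBy (p * k) (onSeq τ x) := by
  have hp : (p : ℤ) ≠ 0 := Nat.cast_ne_zero.2 (NeZero.ne p)
  funext i
  simp only [onSeq, shiftBy]
  rw [Int.add_mul_ediv_left _ _ hp, Int.add_mul_emod_self_left]

theorem iterate_onSeq_shiftBy (τ : A → Fin p → A) (n : ℕ) (k : ℤ) (x : ℤ → A) :
    (onSeq τ)^[n] (shiftBy k x) = shiftBy (p ^ n * k) ((onSeq τ)^[n] x) := by
  induction n with
  | zero => simp
  | succ n ih =>
    rw [Function.iterate_succ_apply', Function.iterate_succ_apply', ih, onSeq_shiftBy]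
    congr 1
    ring

/-- Coordinate `m` lies in the block of order `n` with index `m / p ^ n`, which depends on a single
letter. -/
theorem iterate_onSeq_congr (τ : A → Fin p → A) (n : ℕ) {x y : ℤ → A} {m : ℤ}
    (h : x (m / p ^ n) = y (m / p ^ n)) : (onSeq τ)^[n] x m = (onSeq τ)^[n] y m := by
  induction n generalizing m with
  | zero => simpa using h
  | succ n ih =>
    rw [Function.iterate_succ_apply', Function.iterate_succ_apply']
    simp only [onSeq]
    rw [ih]
    rw [pow_succ', ← Int.ediv_ediv_of_nonneg (by positivity)] at h
    exact h

theorem onSeq_mem (τ : A → Fin p → A) {x : ℤ → A} (hx : x ∈ subshift τ) :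
    onSeq τ x ∈ subshift τ := by
  intro i l
  have hp : (0 : ℤ) < p := Nat.cast_pos.2 (NeZero.pos p)
  obtain ⟨n, a, h⟩ := hx (i / p) (l + 1)
  refine ⟨n + 1, a, ?_⟩
  have h1 := iterate_onWord_infix τ 1 h
  rw [Function.iterate_one, ← subword_onSeq, ← Function.iterate_one (onWord τ), ← iterWord_add,
    add_comm 1 n] at h1
  refine (subword_infix _ (Int.mul_ediv_self_le hp.ne') ?_).trans h1
  have h2 := Int.lt_mul_ediv_self_add (x := i) hp
  have h3 : (l : ℤ) ≤ p * l := le_mul_of_one_le_left (by positivity) (by omega)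
  push_cast
  linarith

theorem iterate_onSeq_mem (τ : A → Fin p → A) (n : ℕ) {x : ℤ → A} (hx : x ∈ subshift τ) :
    (onSeq τ)^[n] x ∈ subshift τ := by
  induction n with
  | zero => exact hx
  | succ n ih => rw [Function.iterate_succ_apply']; exact onSeq_mem τ ih

end Words

/-! ### Minimality, continuity and closedness. -/

section Topological

variable {A : Type*} {p : ℕ} [TopologicalSpace A]

theorem continuous_shiftBy (k : ℤ) : Continuous (shiftBy k : (ℤ → A) → ℤ → A) :=
  continuous_pi fun i => continuous_apply (i + k)

/-- A primitive substitution subshift is minimal. -/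
theorem subshift_subset_of_isClosed {τ : A → Fin p → A} (hp : 2 ≤ p) (hprim : IsPrimitive τ)
    {F : Set (ℤ → A)} (hF : IsClosed F) (hinv : ∀ (k : ℤ), ∀ x ∈ F, shiftBy k x ∈ F)
    (hne : (F ∩ subshift τ).Nonempty) : subshift τ ⊆ F := by
  intro x hx
  obtain ⟨f, hfF, hf⟩ := hne
  choose j hj using fun L : ℕ => exists_subword_eq hp hprim hx hf (-L) (2 * L + 1)
  -- These shifts of `f` agree with `x` on the window [-L, L].
  have hlim : Tendsto (fun L : ℕ => shiftBy (j L + L) f) atTop (𝓝 x) := by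
    refine tendsto_pi_nhds.2 fun i => tendsto_const_nhds.congr' ?_
    filter_upwards [eventually_ge_atTop i.natAbs] with L hL
    have h := subword_eq_iff.1 (hj L) (i + L).toNat (by omega)
    have h1 : ((i + L).toNat : ℤ) = i + L := Int.toNat_of_nonneg (by omega)
    rw [h1] at h
    simp only [shiftBy]
    convert h.symm using 2 <;> ring
  exact hF.mem_of_tendsto hlim (Eventually.of_forall fun L => hinv _ _ hfF)

variable [DiscreteTopology A]

theorem continuous_onSeq [NeZero p] (τ : A → Fin p → A) : Continuous (onSeq τ) :=
  continuous_pi fun i =>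
    (continuous_of_discreteTopology
      (f := fun a => τ a (Fin.ofNat p (i % (p : ℤ)).toNat))).comp (continuous_apply (i / (p : ℤ)))

theorem isClosed_subshift (τ : A → Fin p → A) : IsClosed (subshift τ) := by
  simp only [subshift, Set.ofPred_forall]
  refine isClosed_iInter fun i => isClosed_iInter fun l => ?_
  have hc : Continuous fun (x : ℤ → A) (j : Fin l) => x (i + (j : ℕ)) :=
    continuous_pi fun j => continuous_apply _
  exact (isClosed_discrete
    {g : Fin l → A | ∃ (n : ℕ) (a : A), List.ofFn g <:+: iterWord τ n a}).preimage hc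

end Topological

/-! ### The sets T^i τ^k(X_τ). -/

section Level

variable {A : Type*} {p : ℕ} [NeZero p]

/-- The set `T ^ i (τ ^ k (X_τ))`. -/
def level (τ : A → Fin p → A) (k : ℕ) (i : ℤ) : Set (ℤ → A) :=
  (fun y => shiftBy i ((onSeq τ)^[k] y)) '' subshift τ

theorem level_subset (τ : A → Fin p → A) (k : ℕ) (i : ℤ) : level τ k i ⊆ subshift τ := by
  rintro _ ⟨y, hy, rfl⟩
  exact shiftBy_mem τ i (iterate_onSeq_mem τ k hy)

theorem shiftBy_mem_level {τ : A → Fin p → A} {k : ℕ} {i : ℤ} {x : ℤ → A} (h : x ∈ level τ k i)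
    (j : ℤ) : shiftBy j x ∈ level τ k (i + j) := by
  obtain ⟨y, hy, rfl⟩ := h
  exact ⟨y, hy, by rw [shiftBy_shiftBy, add_comm]⟩

theorem shiftBy_mem_level_iff {τ : A → Fin p → A} {k : ℕ} {i : ℤ} {x : ℤ → A} (j : ℤ) :
    shiftBy j x ∈ level τ k (i + j) ↔ x ∈ level τ k i := by
  refine ⟨fun h => ?_, fun h => shiftBy_mem_level h j⟩
  have := shiftBy_mem_level h (-j)
  rwa [shiftBy_shiftBy, neg_add_cancel, shiftBy_zero, add_neg_cancel_right] at this

theorem level_add_mul (τ : A → Fin p → A) (k : ℕ) (i m : ℤ) :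
    level τ k (i + p ^ k * m) = level τ k i := by
  have key : ∀ i m : ℤ, level τ k (i + p ^ k * m) ⊆ level τ k i := by
    rintro i m _ ⟨y, hy, rfl⟩
    exact ⟨shiftBy m y, shiftBy_mem τ m hy, by
      simp only [iterate_onSeq_shiftBy, shiftBy_shiftBy]⟩
  refine (key i m).antisymm ?_
  have := key (i + p ^ k * m) (-m)
  rwa [mul_neg, add_neg_cancel_right] at this

theorem level_zero (τ : A → Fin p → A) (i : ℤ) : level τ 0 i = subshift τ := by
  have h := level_add_mul τ 0 0 i
  rw [pow_zero, one_mul, zero_add] at h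
  rw [h]
  simp [level, shiftBy_zero]

theorem level_succ_subset (τ : A → Fin p → A) (k : ℕ) (i : ℤ) :
    level τ (k + 1) i ⊆ level τ k i := by
  rintro _ ⟨y, hy, rfl⟩
  exact ⟨onSeq τ y, onSeq_mem τ hy, by simp only [Function.iterate_succ_apply]⟩

theorem level_subset_of_le (τ : A → Fin p → A) {k m : ℕ} (h : k ≤ m) (i : ℤ) :
    level τ m i ⊆ level τ k i := by
  induction m, h using Nat.le_induction with
  | base => exact subset_rfl
  | succ m _ ih => exact (level_succ_subset τ m i).trans ih

theorem onSeq_mem_level {τ : A → Fin p → A} {k : ℕ} {i : ℤ} {x : ℤ → A} (h : x ∈ level τ k i) :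
    onSeq τ x ∈ level τ (k + 1) (p * i) := by
  obtain ⟨y, hy, rfl⟩ := h
  exact ⟨y, hy, by simp only [onSeq_shiftBy, Function.iterate_succ_apply']⟩

theorem level_nonempty {τ : A → Fin p → A} (hne : (subshift τ).Nonempty) (k : ℕ) (i : ℤ) :
    (level τ k i).Nonempty :=
  hne.image _

theorem level_add_congr {τ : A → Fin p → A} {k : ℕ} {i j : ℤ} (h : level τ k i = level τ k j)
    (m : ℤ) : level τ k (i + m) = level τ k (j + m) := by
  ext x
  have hx : x = shiftBy m (shiftBy (-m) x) := by
    rw [shiftBy_shiftBy, add_neg_cancel, shiftBy_zero]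
  rw [hx, shiftBy_mem_level_iff, shiftBy_mem_level_iff, h]

variable [TopologicalSpace A] [DiscreteTopology A]

/-- `T ^ i (τ ^ k (X_τ))` is minimal for `T ^ (p ^ k)`. -/
theorem level_subset_of_isClosed {τ : A → Fin p → A} (hp : 2 ≤ p) (hprim : IsPrimitive τ) {k : ℕ}
    {i : ℤ} {F : Set (ℤ → A)} (hF : IsClosed F)
    (hinv : ∀ m : ℤ, ∀ x ∈ F, shiftBy (p ^ k * m) x ∈ F)
    (hne : (F ∩ level τ k i).Nonempty) : level τ k i ⊆ F := by
  have hc : Continuous fun y => shiftBy i ((onSeq τ)^[k] y) :=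
    (continuous_shiftBy i).comp ((continuous_onSeq τ).iterate k)
  -- Pull `F` back along T^i τ^k: the shift upstairs becomes T^(p^k) downstairs, so minimality of
  -- X_τ applies.
  have h := subshift_subset_of_isClosed (τ := τ) hp hprim (hF.preimage hc) (fun m y hy => by
    simp only [Set.mem_preimage, iterate_onSeq_shiftBy, shiftBy_shiftBy] at hy ⊢
    have := hinv m _ hy
    rwa [shiftBy_shiftBy, add_comm] at this) (by
    obtain ⟨_, hx, y, hy, rfl⟩ := hne
    exact ⟨y, hx, hy⟩)
  rintro _ ⟨y, hy, rfl⟩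
  exact h hy

variable [Finite A]

theorem isCompact_level (τ : A → Fin p → A) (k : ℕ) (i : ℤ) : IsCompact (level τ k i) :=
  (isClosed_subshift τ).isCompact.image
    ((continuous_shiftBy i).comp ((continuous_onSeq τ).iterate k))

theorem isClosed_level (τ : A → Fin p → A) (k : ℕ) (i : ℤ) : IsClosed (level τ k i) :=
  (isCompact_level τ k i).isClosed

/-- Each level is closed, invariant under T^(p^k) and minimal for it, so a common point forces both
inclusions. -/
theorem level_eq_of_inter_nonempty {τ : A → Fin p → A} (hp : 2 ≤ p) (hprim : IsPrimitive τ)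
    {k : ℕ} {i j : ℤ} (hne : (level τ k i ∩ level τ k j).Nonempty) :
    level τ k i = level τ k j := by
  have key : ∀ i j, (level τ k i ∩ level τ k j).Nonempty → level τ k j ⊆ level τ k i := by
    intro i j h
    refine level_subset_of_isClosed hp hprim (isClosed_level τ k i) (fun m x hx => ?_) h
    rw [← level_add_mul τ k i m]
    exact shiftBy_mem_level hx _
  exact (key j i (Set.inter_comm _ _ ▸ hne)).antisymm (key i j hne)

/-- Every point of `X_τ` is a shift of the image of a point of `X_τ`. -/
theorem exists_mem_level_one {τ : A → Fin p → A} (hp : 2 ≤ p) (hprim : IsPrimitive τ) {x : ℤ → A}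
    (hx : x ∈ subshift τ) : ∃ r : Fin p, x ∈ level τ 1 (r : ℕ) := by
  have hmod : ∀ i : ℤ, ∃ r : Fin p, level τ 1 i = level τ 1 (r : ℕ) := by
    intro i
    have hpos : (0 : ℤ) < p := by omega
    have h0 := Int.emod_nonneg i hpos.ne'
    have h1 := Int.emod_lt_of_pos i hpos
    refine ⟨⟨(i % p).toNat, by omega⟩, ?_⟩
    simp only [Int.toNat_of_nonneg h0]
    rw [← level_add_mul τ 1 (i % p) (i / p), pow_one, Int.emod_add_mul_ediv]
  -- The finite union of the levels of order one is closed, shift-invariant and contains τ(x), so by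
  -- minimality it covers X_τ.
  have h := subshift_subset_of_isClosed (τ := τ) hp hprim (F := ⋃ r : Fin p, level τ 1 (r : ℕ))
    (isClosed_iUnion_of_finite fun r => isClosed_level τ 1 _) (fun k x hx => by
      obtain ⟨r, hr⟩ := Set.mem_iUnion.1 hx
      obtain ⟨r', hr'⟩ := hmod ((r : ℕ) + k)
      exact Set.mem_iUnion.2 ⟨r', hr' ▸ shiftBy_mem_level hr k⟩)
    ⟨onSeq τ x, Set.mem_iUnion.2 ⟨⟨0, by omega⟩, x, hx, by simp [shiftBy_zero]⟩, onSeq_mem τ hx⟩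
  exact Set.mem_iUnion.1 (h hx)

theorem exists_mem_level {τ : A → Fin p → A} (hp : 2 ≤ p) (hprim : IsPrimitive τ) {x : ℤ → A}
    (hx : x ∈ subshift τ) (k : ℕ) : ∃ i, x ∈ level τ k i := by
  induction k generalizing x with
  | zero => exact ⟨0, by rwa [level_zero]⟩
  | succ k ih =>
    obtain ⟨r, y, hy, rfl⟩ := exists_mem_level_one hp hprim hx
    obtain ⟨i, hi⟩ := ih hy
    exact ⟨_, shiftBy_mem_level (onSeq_mem_level hi) _⟩

end Level

/-! ### Counting points through finite windows. -/

section Counting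

variable {A : Type*}

/-- If maps into a finite set `W` separate the points of `S` on arbitrarily large windows, then `S`
has at most as many points as `W`. -/
theorem finite_of_separating {B : Type*} {S : Set (ℤ → A)} {W : Set B} (hW : W.Finite)
    (h : ∀ L : ℕ, ∃ f : (ℤ → A) → B, (∀ x ∈ S, f x ∈ W) ∧
      ∀ x ∈ S, ∀ x' ∈ S, f x = f x' → ∀ i : ℤ, i.natAbs ≤ L → x i = x' i) :
    S.Finite ∧ S.ncard ≤ W.ncard := by
  have key : ∀ F : Finset (ℤ → A), (F : Set (ℤ → A)) ⊆ S → F.card ≤ W.ncard := by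
    intro F hF
    have hL : ∀ᶠ L : ℕ in atTop, ∀ x ∈ F, ∀ x' ∈ F,
        (∀ i : ℤ, i.natAbs ≤ L → x i = x' i) → x = x' := by
      simp only [eventually_all_finset]
      intro x _ x' _
      by_cases hxx : x = x'
      · exact Eventually.of_forall fun _ _ => hxx
      · obtain ⟨i, hi⟩ := Function.ne_iff.1 hxx
        filter_upwards [eventually_ge_atTop i.natAbs] with L hL h
        exact absurd (h i hL) hi
    obtain ⟨L, hL⟩ := hL.exists
    obtain ⟨f, hfW, hf⟩ := h L
    rw [← Set.ncard_coe_finset]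
    exact Set.ncard_le_ncard_of_injOn f (fun x hx => hfW x (hF hx))
      (fun x hx x' hx' he => hL x hx x' hx' (hf x (hF hx) x' (hF hx') he)) hW
  have hfin : S.Finite := by
    by_contra hinf
    obtain ⟨F, hFS, hF⟩ := Set.Infinite.exists_subset_card_eq hinf (W.ncard + 1)
    have := key F hFS
    omega
  refine ⟨hfin, ?_⟩
  rw [Set.ncard_eq_toFinset_card S hfin]
  exact key _ (by simp)

end Counting

/-! ### Recognizability and injectivity. -/

section Recognizability

variable {A : Type*} {p : ℕ} [NeZero p]

/-- The periods form a subgroup of ℤ, hence a cyclic one. -/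
theorem exists_level_eq_iff_dvd (τ : A → Fin p → A) (k : ℕ) :
    ∃ c : ℕ, ∀ i, level τ k i = level τ k 0 ↔ (c : ℤ) ∣ i := by
  let H : AddSubgroup ℤ :=
    { carrier := {i | level τ k i = level τ k 0}
      zero_mem' := rfl
      add_mem' := fun {a b} ha hb => by
        have := level_add_congr ha b
        rw [zero_add] at this
        exact this.trans hb
      neg_mem' := fun {a} ha => by
        have := level_add_congr ha (-a)
        rw [zero_add, add_neg_cancel] at this
        exact this.symm }
  obtain ⟨a, ha⟩ := Int.subgroup_cyclic H
  refine ⟨a.natAbs, fun i => ?_⟩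
  have h : level τ k i = level τ k 0 ↔ i ∈ H := Iff.rfl
  rw [h, ha, AddSubgroup.mem_closure_singleton, Int.natAbs_dvd]
  simp only [smul_eq_mul, dvd_iff_exists_eq_mul_left, eq_comm]

variable [Finite A]

/-- If the sets `T ^ i (τ ^ k (X_τ))` recur with a period `c` much smaller than `p ^ k`, then all
points of `X_τ` are periodic with the same period. -/
theorem finite_of_factorial_mul_le {τ : A → Fin p → A} (hp : 2 ≤ p) (hprim : IsPrimitive τ)
    {k c : ℕ} (hc : 0 < c) (hlev : ∀ i : ℤ, (c : ℤ) ∣ i → level τ k i = level τ k 0)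
    (hle : (Nat.card (Fin 3 → A)).factorial * c ≤ p ^ k) : (subshift τ).Finite := by
  let _ : TopologicalSpace A := ⊥
  have _ : DiscreteTopology A := ⟨rfl⟩
  set N := Nat.card (Fin 3 → A) with hN
  set q := N.factorial * c with hq
  have hqpos : 0 < q := Nat.mul_pos N.factorial_pos hc
  have hpk : (0 : ℤ) < (p : ℤ) ^ k := by exact_mod_cast hqpos.trans_le hle
  have hNq : (N * c : ℤ) ≤ p ^ k := by
    exact_mod_cast (Nat.mul_le_mul_right c N.self_le_factorial).trans hle
  have hle' : (q : ℤ) ≤ p ^ k := by exact_mod_cast hle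
  have hcZ : (0 : ℤ) < c := by exact_mod_cast hc
  have main : ∀ x ∈ subshift τ, x q = x 0 := by
    intro x hx
    obtain ⟨i, hi⟩ := exists_mem_level hp hprim hx k
    rw [← Int.emod_add_mul_ediv i (p ^ k), level_add_mul] at hi
    have hr0 := Int.emod_nonneg i hpk.ne'
    have hr1 := Int.emod_lt_of_pos i hpk
    set r := i % (p : ℤ) ^ k
    have hmem : ∀ j : ℕ, x ∈ level τ k (r + j * c) := by
      intro j
      have := level_add_congr (hlev (j * c) (dvd_mul_left _ _)) r
      rw [zero_add, add_comm] at this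
      rwa [this]
    choose y hy hxy using hmem
    have hxn : ∀ (j : ℕ) (n : ℤ), x n = (onSeq τ)^[k] (y j) (n + (r + j * c)) :=
      fun j n => (congrFun (hxy j) n).symm
    -- Pigeonhole: `N + 1` sequences, at most `N` words on the coordinates 0, 1, 2.
    obtain ⟨j, j', hlt, hj'N, hjj⟩ : ∃ j j' : ℕ, j < j' ∧ j' ≤ N ∧
        ∀ t : Fin 3, y j (t : ℕ) = y j' (t : ℕ) := by
      have hninj : ¬ Function.Injective fun (j : Fin (N + 1)) (t : Fin 3) => y j (t : ℕ) := by
        intro hinj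
        have := Nat.card_le_card_of_injective _ hinj
        rw [Nat.card_eq_fintype_card, Fintype.card_fin, ← hN] at this
        omega
      simp only [Function.Injective, not_forall] at hninj
      obtain ⟨a, b, hab, hne⟩ := hninj
      rcases lt_or_gt_of_ne hne with h | h
      · exact ⟨a, b, h, by omega, fun t => congrFun hab t⟩
      · exact ⟨b, a, h, by omega, fun t => (congrFun hab t).symm⟩
    have hjc : (j' * c : ℤ) ≤ N * c := by
      exact_mod_cast Nat.mul_le_mul_right c hj'N
    -- Both `y j` and `y j'` compute `x`. As `n`, `r` and `j' * c` are each at most `p ^ k`, with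
    -- `r` strictly less, the position read is below `3 * p ^ k`: three letters suffice.
    have hper : ∀ n : ℤ, 0 ≤ n → n ≤ p ^ k → x (n + ((j' - j : ℕ) * c)) = x n := by
      intro n hn0 hn
      rw [hxn j, hxn j' n]
      have hidx : n + ((j' - j : ℕ) * c) + (r + j * c) = n + (r + j' * c) := by
        rw [Nat.cast_sub hlt.le]; ring
      rw [hidx]
      apply iterate_onSeq_congr
      have h0 : 0 ≤ n + (r + j' * c) := by positivity
      have h1 : n + (r + j' * c) < 3 * p ^ k := by linarith
      have h2 : 0 ≤ (n + (r + j' * c)) / (p : ℤ) ^ k := Int.ediv_nonneg h0 hpk.le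
      have h3 : (n + (r + j' * c)) / (p : ℤ) ^ k < 3 := Int.ediv_lt_of_lt_mul hpk h1
      have := hjj ⟨((n + (r + j' * c)) / (p : ℤ) ^ k).toNat, by omega⟩
      simpa only [Int.toNat_of_nonneg h2] using this
    -- The gap `j' - j` depends on `x`; the factorial is a common multiple of all possible gaps. The
    -- steps from 0 to `q` stay in [0, p^k], where `hper` applies.
    obtain ⟨m, hm⟩ : (j' - j) ∣ N.factorial := Nat.dvd_factorial (by omega) (by omega)
    have hmul : ∀ l : ℕ, l ≤ m → x (l * ((j' - j : ℕ) * c)) = x 0 := by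
      intro l
      induction l with
      | zero => simp
      | succ l ih =>
        intro hl
        rw [← ih (by omega), ← hper (l * ((j' - j : ℕ) * c)) (by positivity)]
        · congr 1
          push_cast
          ring
        · refine le_trans ?_ hle'
          rw [hq, hm]
          have : l * ((j' - j) * c) ≤ (j' - j) * m * c :=
            (Nat.mul_le_mul_right _ (by omega : l ≤ m)).trans (by
              rw [← mul_assoc, mul_comm m])
          exact_mod_cast this
    rw [← hmul m le_rfl, hq, hm]
    congr 1
    push_cast
    ring
  have hshift : ∀ x ∈ subshift τ, ∀ i : ℤ, x (i + q) = x i := by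
    intro x hx i
    have := main _ (shiftBy_mem τ i hx)
    simpa [shiftBy, add_comm] using this
  have hperiod : ∀ x ∈ subshift τ, ∀ i : ℤ, x i = x (i % q) := by
    intro x hx i
    have h : Function.Periodic x (q : ℤ) := hshift x hx
    conv_lhs => rw [← Int.emod_add_mul_ediv i q, mul_comm]
    exact h.int_mul _ _
  refine (finite_of_separating (W := (Set.univ : Set (Fin q → A))) Set.finite_univ fun L =>
    ⟨fun x t => x (t : ℕ), fun _ _ => Set.mem_univ _, fun x hx x' hx' he i _ => ?_⟩).1
  have hqZ : (0 : ℤ) < q := by exact_mod_cast hqpos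
  have h0 := Int.emod_nonneg i hqZ.ne'
  have h1 := Int.emod_lt_of_pos i hqZ
  rw [hperiod x hx, hperiod x' hx']
  have := congrFun he ⟨(i % q).toNat, by omega⟩
  simpa only [Int.toNat_of_nonneg h0] using this

/-- A sequence of divisors `c k` of `p ^ k` with `c k ∣ c (k + 1) ∣ p * c k` and bounded quotients
`p ^ k / c k` is eventually divisible by each power of `p`. -/
theorem exists_pow_dvd {p : ℕ} (hp : 0 < p) {c d : ℕ → ℕ} (hcd : ∀ k, c k * d k = p ^ k)
    (hc : ∀ k, c (k + 1) ∣ p * c k) {B : ℕ} (hB : ∀ k, d k ≤ B) (j : ℕ) :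
    ∃ m, j ≤ m ∧ p ^ j ∣ c m := by
  have hpos : ∀ k, 0 < c k * d k := fun k => by rw [hcd]; positivity
  have hmono : Monotone d := by
    refine monotone_nat_of_le_succ fun k => ?_
    obtain ⟨t, ht⟩ := hc k
    have h : c (k + 1) * d (k + 1) = c (k + 1) * (t * d k) := by
      rw [hcd, pow_succ', ← hcd k, ← mul_assoc, ht, mul_assoc]
    have hcpos : 0 < c (k + 1) := Nat.pos_of_mul_pos_right (hpos (k + 1))
    have hd := Nat.eq_of_mul_eq_mul_left hcpos h
    rw [hd]
    refine Nat.le_mul_of_pos_left _ (Nat.pos_of_ne_zero ?_)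
    rintro rfl
    have := hpos k
    have := Nat.pos_of_mul_pos_right this
    simp only [mul_zero, mul_eq_zero] at ht
    omega
  -- A bounded monotone sequence of naturals is eventually constant; from then on `c` gains a factor
  -- `p` at each step.
  obtain ⟨n, hn⟩ : ∃ n, ∀ m, n ≤ m → d n = d m := by
    by_contra! hcon
    have hgrow : ∀ b : ℕ, ∃ k, b ≤ d k := by
      intro b
      induction b with
      | zero => exact ⟨0, Nat.zero_le _⟩
      | succ b ih =>
        obtain ⟨k, hk⟩ := ih
        obtain ⟨m, hkm, hne⟩ := hcon k
        have := hmono hkm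
        exact ⟨m, by omega⟩
    obtain ⟨k, hk⟩ := hgrow (B + 1)
    have := hB k
    omega
  refine ⟨n + j, by omega, c n, ?_⟩
  have hdpos : 0 < d n := Nat.pos_of_mul_pos_left (hpos n)
  apply Nat.eq_of_mul_eq_mul_right hdpos
  conv_lhs => rw [hn (n + j) (by omega), hcd]
  rw [mul_assoc, hcd, pow_add, mul_comm]

/-- The sets `T ^ i (τ ^ k (X_τ))` and `τ ^ k (X_τ)` meet only when `p ^ k` divides `i`. -/
theorem pow_dvd_sub_of_mem_level {τ : A → Fin p → A} (hp : 2 ≤ p) (hprim : IsPrimitive τ)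
    (hinf : (subshift τ).Infinite) {k : ℕ} {i j : ℤ} {x : ℤ → A} (hi : x ∈ level τ k i)
    (hj : x ∈ level τ k j) : (p : ℤ) ^ k ∣ i - j := by
  let _ : TopologicalSpace A := ⊥
  have _ : DiscreteTopology A := ⟨rfl⟩
  choose c hc using exists_level_eq_iff_dvd τ
  have hpos : ∀ n : ℕ, 0 < p ^ n := fun n => Nat.pow_pos (by omega)
  have hcp : ∀ n, c n ∣ p ^ n := by
    intro n
    have h := (hc n (p ^ n)).1 (by simpa using level_add_mul τ n 0 1)
    exact_mod_cast h
  choose d hd using hcp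
  have hsucc : ∀ n, c (n + 1) ∣ p * c n := by
    intro n
    have h1 : level τ (n + 1) (p * c n) = level τ (n + 1) 0 := by
      refine level_eq_of_inter_nonempty hp hprim ?_
      obtain ⟨x, hx⟩ := level_nonempty hinf.nonempty (τ := τ) n (c n)
      have hx0 : x ∈ level τ n 0 := (hc n (c n)).2 dvd_rfl ▸ hx
      exact ⟨onSeq τ x, onSeq_mem_level hx, by simpa using onSeq_mem_level hx0⟩
    exact_mod_cast (hc _ _).1 h1
  have hB : ∀ n, d n ≤ (Nat.card (Fin 3 → A)).factorial := by
    intro n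
    by_contra! hlt
    have hcn : 0 < c n := Nat.pos_of_ne_zero fun h0 => by
      have := hd n
      rw [h0, zero_mul] at this
      exact (hpos n).ne' this
    refine hinf (finite_of_factorial_mul_le hp hprim hcn (fun i hi => (hc n i).2 hi) ?_)
    rw [hd n, mul_comm]
    exact Nat.mul_le_mul_left _ hlt.le
  obtain ⟨m, hkm, hm⟩ := exists_pow_dvd (by omega) (fun n => (hd n).symm) hsucc hB k
  -- the union of the `T ^ (p ^ k * l) (τ ^ m (X_τ))` is all of `τ ^ k (X_τ)`
  have hm' : (p : ℤ) ^ k ∣ c m := by exact_mod_cast hm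
  have hcover : level τ k 0 ⊆ ⋃ l : Fin (p ^ m), level τ m (p ^ k * (l : ℕ)) := by
    refine level_subset_of_isClosed hp hprim
      (isClosed_iUnion_of_finite fun l => isClosed_level τ m _) (fun t x hx => ?_) ?_
    · obtain ⟨l, hl⟩ := Set.mem_iUnion.1 hx
      have hl' := shiftBy_mem_level hl (p ^ k * t)
      have hposZ : (0 : ℤ) < p ^ m := by exact_mod_cast hpos m
      have h0 := Int.emod_nonneg ((l : ℕ) + t) hposZ.ne'
      have h1 := Int.emod_lt_of_pos ((l : ℕ) + t) hposZ
      refine Set.mem_iUnion.2 ⟨⟨(((l : ℕ) + t) % (p : ℤ) ^ m).toNat, by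
        zify; rw [Int.toNat_of_nonneg h0]; exact h1⟩, ?_⟩
      simp only [Int.toNat_of_nonneg h0]
      rw [← level_add_mul τ m _ (p ^ k * (((l : ℕ) + t) / (p : ℤ) ^ m))]
      convert hl' using 1
      congr 1
      have := Int.emod_add_mul_ediv ((l : ℕ) + t) ((p : ℤ) ^ m)
      linear_combination (p : ℤ) ^ k * this
    · obtain ⟨x, hx⟩ := level_nonempty hinf.nonempty (τ := τ) m 0
      exact ⟨x, Set.mem_iUnion.2 ⟨⟨0, hpos m⟩, by simpa using hx⟩,
        level_subset_of_le τ hkm 0 hx⟩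
  have heq : level τ k (i - j) = level τ k 0 := by
    have := level_add_congr (level_eq_of_inter_nonempty hp hprim ⟨x, hi, hj⟩) (-j)
    rwa [add_neg_cancel, ← sub_eq_add_neg] at this
  -- A point of the finer level at `i - j` also lies in one at some `p ^ k * l`, so `c m` divides
  -- the difference of the two offsets, and `p ^ k` divides `c m`.
  obtain ⟨z, hz⟩ := level_nonempty hinf.nonempty (τ := τ) m (i - j)
  have hz0 : z ∈ level τ k 0 := heq ▸ level_subset_of_le τ hkm _ hz
  obtain ⟨l, hl⟩ := Set.mem_iUnion.1 (hcover hz0)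
  have h1 := level_add_congr (level_eq_of_inter_nonempty hp hprim ⟨z, hz, hl⟩) (-(p ^ k * (l : ℕ)))
  rw [add_neg_cancel] at h1
  have h2 := hm'.trans ((hc m _).1 h1)
  have h3 := dvd_add h2 (dvd_mul_right ((p : ℤ) ^ k) (l : ℕ))
  simpa using h3

/-- A primitive aperiodic substitution of constant length is injective on its subshift. -/
theorem injOn_onSeq {τ : A → Fin p → A} (hp : 2 ≤ p) (hprim : IsPrimitive τ)
    (hinf : (subshift τ).Infinite) : Set.InjOn (onSeq τ) (subshift τ) := by
  let _ : TopologicalSpace A := ⊥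
  have _ : DiscreteTopology A := ⟨rfl⟩
  -- the kernels of the powers of `τ` on letters stabilize
  let ker : ℕ →o Set (A × A) :=
    ⟨fun k => {q | iterWord τ k q.1 = iterWord τ k q.2}, monotone_nat_of_le_succ fun k q hq => by
      have hq' : iterWord τ k q.1 = iterWord τ k q.2 := hq
      change iterWord τ (k + 1) q.1 = iterWord τ (k + 1) q.2
      rw [add_comm, iterWord_add, iterWord_add, hq']⟩
  obtain ⟨k, hk⟩ := WellFoundedGT.monotone_chain_condition ker
  have hker : ∀ a b, iterWord τ (k + 1) a = iterWord τ (k + 1) b →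
      iterWord τ k a = iterWord τ k b := fun a b hab =>
    (hk (k + 1) (by omega)).ge (show (a, b) ∈ ker (k + 1) from hab)
  intro y hy y' hy' he
  obtain ⟨i, hi⟩ := exists_mem_level hp hprim hy k
  obtain ⟨j, hj⟩ := exists_mem_level hp hprim hy' k
  -- The common image has offsets `p * i` and `p * j` at order `k + 1`, so `y` and `y'` can be given
  -- the same offset at order `k`.
  have hdvd := pow_dvd_sub_of_mem_level hp hprim hinf (onSeq_mem_level hi)
    (he ▸ onSeq_mem_level hj)
  have hpne : (p : ℤ) ≠ 0 := by omega
  rw [pow_succ', ← mul_sub, mul_dvd_mul_iff_left hpne] at hdvd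
  obtain ⟨t, ht⟩ := hdvd
  obtain rfl : i = j + p ^ k * t := by linear_combination ht
  rw [level_add_mul] at hi
  obtain ⟨u, hu, rfl⟩ := hi
  obtain ⟨u', hu', rfl⟩ := hj
  simp only [onSeq_shiftBy, ← Function.iterate_succ_apply' (onSeq τ) k] at he
  have he' : (onSeq τ)^[k + 1] u = (onSeq τ)^[k + 1] u' := by
    have := congrArg (shiftBy (-(p * j))) he
    simpa only [shiftBy_shiftBy, neg_add_cancel, shiftBy_zero] using this
  have hkk : (onSeq τ)^[k] u = (onSeq τ)^[k] u' := by
    funext m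
    have hposZ : (0 : ℤ) < p ^ k := by positivity
    have hletter : iterWord τ k (u (m / p ^ k)) = iterWord τ k (u' (m / p ^ k)) := by
      -- Equal blocks of order `k + 1` come from letters whose blocks of order `k` already agree.
      apply hker
      rw [← subword_iterate_onSeq_letter, ← subword_iterate_onSeq_letter, he']
    rw [← subword_iterate_onSeq_letter, ← subword_iterate_onSeq_letter, subword_eq_iff] at hletter
    have h0 := Int.emod_nonneg m hposZ.ne'
    have h1 := Int.emod_lt_of_pos m hposZ
    have := hletter (m % p ^ k).toNat (by zify; rwa [Int.toNat_of_nonneg h0])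
    rwa [Int.toNat_of_nonneg h0, Int.mul_ediv_add_emod] at this
  simp only [hkk]

end Recognizability

/-! ### Unique desubstitution and the coordinates of π. -/

section Desubstitution

variable {A : Type*} {p : ℕ} [NeZero p]

theorem Desubstitutes.eq_shiftBy {τ : A → Fin p → A} {x : subshift τ} {y : ℕ → subshift τ}
    {δ : ℕ → Fin p} (h : Desubstitutes τ x y δ) (k : ℕ) :
    x.1 = shiftBy (∑ i ∈ Finset.range k, ((δ i : ℕ) : ℤ) * p ^ i) ((onSeq τ)^[k] (y k).1) := by
  induction k with
  | zero => simp [shiftBy_zero, h.1]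
  | succ k ih =>
    rw [Finset.sum_range_succ, Function.iterate_succ_apply, h.2 k, iterate_onSeq_shiftBy,
      shiftBy_shiftBy, ih]
    congr 1
    ring

variable [Finite A]

theorem exists_onSeq_eq_shiftBy {τ : A → Fin p → A} (hp : 2 ≤ p) (hprim : IsPrimitive τ)
    (x : subshift τ) :
    ∃ q : subshift τ × Fin p, onSeq τ q.1.1 = shiftBy (-((q.2 : ℕ) : ℤ)) x.1 := by
  let _ : TopologicalSpace A := ⊥
  have _ : DiscreteTopology A := ⟨rfl⟩
  obtain ⟨r, y, hy, hyx⟩ := exists_mem_level_one hp hprim x.2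
  refine ⟨⟨⟨y, hy⟩, r⟩, ?_⟩
  rw [← hyx, shiftBy_shiftBy, neg_add_cancel, shiftBy_zero, Function.iterate_one]

/-- The digits are congruent modulo `p` and differ by less than `p`; once they agree, injectivity of
τ on X_τ gives `y = y'`. -/
theorem eq_and_eq_of_onSeq_eq_shiftBy {τ : A → Fin p → A} (hp : 2 ≤ p) (hprim : IsPrimitive τ)
    (hinf : (subshift τ).Infinite) {x y y' : subshift τ} {r r' : Fin p}
    (h : onSeq τ y.1 = shiftBy (-((r : ℕ) : ℤ)) x.1)
    (h' : onSeq τ y'.1 = shiftBy (-((r' : ℕ) : ℤ)) x.1) : y = y' ∧ r = r' := by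
  have mem : ∀ {y : subshift τ} {r : Fin p}, onSeq τ y.1 = shiftBy (-((r : ℕ) : ℤ)) x.1 →
      x.1 ∈ level τ 1 (r : ℕ) := fun {y r} h =>
    ⟨y.1, y.2, by
      simp only [Function.iterate_one, h, shiftBy_shiftBy, add_neg_cancel, shiftBy_zero]⟩
  have hd := pow_dvd_sub_of_mem_level hp hprim hinf (mem h) (mem h')
  rw [pow_one] at hd
  have hrr : ((r : ℕ) : ℤ) - (r' : ℕ) = 0 :=
    Int.eq_zero_of_abs_lt_dvd hd (by rw [abs_lt]; omega)
  obtain rfl : r = r' := Fin.ext (by omega)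
  exact ⟨Subtype.ext (injOn_onSeq hp hprim hinf y.2 y'.2 (h.trans h'.symm)), rfl⟩

theorem existsUnique_desubstitutes {τ : A → Fin p → A} (hp : 2 ≤ p) (hprim : IsPrimitive τ)
    (hinf : (subshift τ).Infinite) (x : subshift τ) :
    ∃! q : (ℕ → subshift τ) × (ℕ → Fin p), Desubstitutes τ x q.1 q.2 := by
  choose f hf using exists_onSeq_eq_shiftBy hp hprim
  let y : ℕ → subshift τ := fun n => (fun z => (f z).1)^[n] x
  have hy : ∀ n, y (n + 1) = (f (y n)).1 := fun n => Function.iterate_succ_apply' _ n x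
  refine ⟨⟨y, fun n => (f (y n)).2⟩, ⟨rfl, fun n => by simp only [hy]; exact hf (y n)⟩, ?_⟩
  rintro ⟨z, δ⟩ ⟨hz0, hz⟩
  have hzy : ∀ n, z n = y n := by
    intro n
    induction n with
    | zero => exact hz0
    | succ n ih =>
      rw [hy, ← ih]
      exact (eq_and_eq_of_onSeq_eq_shiftBy hp hprim hinf (hz n) (hf (z n))).1
  refine Prod.ext (funext hzy) (funext fun n => ?_)
  change δ n = (f (y n)).2
  rw [← hzy n]
  exact (eq_and_eq_of_onSeq_eq_shiftBy hp hprim hinf (hz n) (hf (z n))).2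

/-- The `k`-th coordinate of the odometer point of `x` is the residue of any `n` with
`x ∈ T ^ n (τ ^ k (X_τ))`. -/
theorem toOdometer_apply {τ : A → Fin p → A} (hp : 2 ≤ p) (hprim : IsPrimitive τ)
    (hinf : (subshift τ).Infinite) {x : subshift τ} {k : ℕ} {n : ℤ} (h : x.1 ∈ level τ k n) :
    (toOdometer τ x).1 k = (n : ZMod (p ^ k)) := by
  have hex := (existsUnique_desubstitutes hp hprim hinf x).exists
  rw [toOdometer, dif_pos hex]
  have hmem : x.1 ∈ level τ k (∑ i ∈ Finset.range k, ((hex.choose.2 i : ℕ) : ℤ) * p ^ i) :=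
    ⟨_, (hex.choose.1 k).2, (hex.choose_spec.eq_shiftBy k).symm⟩
  have hd := pow_dvd_sub_of_mem_level hp hprim hinf h hmem
  have hz := (ZMod.intCast_zmod_eq_zero_iff_dvd _ (p ^ k)).2 (by exact_mod_cast hd)
  rw [Int.cast_sub, sub_eq_zero] at hz
  rw [hz]
  simp [ofDigits]

theorem mem_level_of_toOdometer_apply {τ : A → Fin p → A} (hp : 2 ≤ p) (hprim : IsPrimitive τ)
    (hinf : (subshift τ).Infinite) {x : subshift τ} {k : ℕ} {n : ℤ}
    (h : (toOdometer τ x).1 k = (n : ZMod (p ^ k))) : x.1 ∈ level τ k n := by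
  let _ : TopologicalSpace A := ⊥
  have _ : DiscreteTopology A := ⟨rfl⟩
  obtain ⟨i, hi⟩ := exists_mem_level hp hprim x.2 k
  rw [toOdometer_apply hp hprim hinf hi, ZMod.intCast_eq_intCast_iff_dvd_sub] at h
  obtain ⟨m, hm⟩ := h
  obtain rfl : n = i + p ^ k * m := by push_cast at hm; linear_combination hm
  rwa [level_add_mul]

end Desubstitution

/-! ### The factor map onto the odometer. -/

section Factor

variable {A : Type*} [Finite A] {p : ℕ} [NeZero p]

theorem toOdometer_shift {τ : A → Fin p → A} (hp : 2 ≤ p) (hprim : IsPrimitive τ)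
    (hinf : (subshift τ).Infinite) (x : subshift τ) :
    toOdometer τ (shift τ x) = addOne p (toOdometer τ x) := by
  let _ : TopologicalSpace A := ⊥
  have _ : DiscreteTopology A := ⟨rfl⟩
  refine Subtype.ext (funext fun k => ?_)
  obtain ⟨i, hi⟩ := exists_mem_level hp hprim x.2 k
  have hs : (shift τ x).1 ∈ level τ k (i + 1) := shiftBy_mem_level hi 1
  rw [toOdometer_apply hp hprim hinf hs]
  change _ = (toOdometer τ x).1 k + 1
  rw [toOdometer_apply hp hprim hinf hi, Int.cast_add, Int.cast_one]

theorem val_odometer_succ_mod (z : odometer p) (k : ℕ) :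
    (z.1 (k + 1)).val % p ^ k = (z.1 k).val := by
  rw [← z.2 k, ZMod.castHom_apply, ZMod.cast_eq_val, ZMod.val_natCast]

variable [TopologicalSpace A] [DiscreteTopology A]

/-- Fibres of a coordinate are levels, hence closed, and each coordinate takes finitely many values.
-/
theorem continuous_toOdometer {τ : A → Fin p → A} (hp : 2 ≤ p) (hprim : IsPrimitive τ)
    (hinf : (subshift τ).Infinite) : Continuous (toOdometer τ) := by
  refine continuous_induced_rng.2 (continuous_pi fun k => ?_)
  have hfib : ∀ v : ZMod (p ^ k), IsClosed {x : subshift τ | (toOdometer τ x).1 k = v} := by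
    intro v
    have : {x : subshift τ | (toOdometer τ x).1 k = v} =
        Subtype.val ⁻¹' level τ k (v.val : ℤ) := by
      ext x
      constructor
      · intro h
        exact mem_level_of_toOdometer_apply hp hprim hinf (by simpa using h)
      · intro h
        simpa using toOdometer_apply hp hprim hinf h
    rw [this]
    exact (isClosed_level τ k _).preimage continuous_subtype_val
  refine continuous_iff_isClosed.2 fun s _ => ?_
  have : (fun x : subshift τ => (toOdometer τ x).1 k) ⁻¹' s =
      ⋃ v ∈ s, {x : subshift τ | (toOdometer τ x).1 k = v} := by
    ext x; simp
  change IsClosed ((fun x : subshift τ => (toOdometer τ x).1 k) ⁻¹' s)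
  rw [this]
  exact s.toFinite.isClosed_biUnion fun v _ => hfib v

/-- The coordinates of `z` prescribe a nested sequence of nonempty compact levels; a common point
maps to `z`. -/
theorem surjective_toOdometer {τ : A → Fin p → A} (hp : 2 ≤ p) (hprim : IsPrimitive τ)
    (hinf : (subshift τ).Infinite) : Function.Surjective (toOdometer τ) := by
  intro z
  have hanti : ∀ k, level τ (k + 1) ((z.1 (k + 1)).val : ℤ) ⊆ level τ k ((z.1 k).val : ℤ) := by
    intro k
    refine (level_succ_subset τ k _).trans_eq ?_
    rw [← val_odometer_succ_mod z k]
    conv_lhs => rw [← Nat.mod_add_div (z.1 (k + 1)).val (p ^ k)]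
    push_cast
    rw [level_add_mul]
  obtain ⟨x, hx⟩ := IsCompact.nonempty_iInter_of_sequence_nonempty_isCompact_isClosed
    (fun k => level τ k ((z.1 k).val : ℤ)) hanti
    (fun k => level_nonempty hinf.nonempty k _) (isCompact_level τ 0 _)
    (fun k => isClosed_level τ k _)
  rw [Set.mem_iInter] at hx
  refine ⟨⟨x, level_subset τ _ _ (hx 0)⟩, Subtype.ext (funext fun k => ?_)⟩
  rw [toOdometer_apply hp hprim hinf (hx k)]
  simp

end Factor

/-! ### Words of length two and three. -/

section Complexity

variable {A : Type*} {p : ℕ}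

theorem subword_mem_wordsOfLength {τ : A → Fin p → A} {x : ℤ → A} (hx : x ∈ subshift τ) (i : ℤ)
    (l : ℕ) : subword x i l ∈ wordsOfLength τ l :=
  ⟨x, hx, i, rfl⟩

variable [Finite A]

theorem finite_wordsOfLength (τ : A → Fin p → A) (l : ℕ) : (wordsOfLength τ l).Finite :=
  (List.finite_length_eq A l).subset fun w ⟨x, _, i, hw⟩ => by
    rw [hw]; exact length_subword x i l

/-- An infinite subshift has more words of length three than words of length two. -/
theorem ncard_wordsOfLength_two_lt_three {τ : A → Fin p → A} (hinf : (subshift τ).Infinite) :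
    (wordsOfLength τ 2).ncard < (wordsOfLength τ 3).ncard := by
  by_contra! hle
  have htake : ∀ (x : ℤ → A) (i : ℤ), (subword x i 3).take 2 = subword x i 2 := by
    intro x i
    rw [subword_add x i 2 1]
    exact List.take_left' (length_subword x i 2)
  have himage : List.take 2 '' wordsOfLength τ 3 = wordsOfLength τ 2 := by
    ext w
    constructor
    · rintro ⟨_, ⟨x, hx, i, rfl⟩, rfl⟩
      exact ⟨x, hx, i, htake x i⟩
    · rintro ⟨x, hx, i, rfl⟩
      exact ⟨_, ⟨x, hx, i, rfl⟩, htake x i⟩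
  -- With no more words of length 3 than of length 2, each word of length 2 has a unique right
  -- extension, so the word at `-L` determines everything to its right.
  have hinj : Set.InjOn (List.take 2) (wordsOfLength τ 3) :=
    Set.injOn_of_ncard_image_eq (le_antisymm (Set.ncard_image_le (finite_wordsOfLength τ 3))
      (himage ▸ hle)) (finite_wordsOfLength τ 3)
  refine hinf (finite_of_separating (finite_wordsOfLength τ 2) fun L =>
    ⟨fun x => subword x (-L) 2, fun x hx => subword_mem_wordsOfLength hx _ _,
      fun x hx x' hx' he i hi => ?_⟩).1
  have hpair : ∀ n : ℕ, subword x (-L + n) 2 = subword x' (-L + n) 2 := by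
    intro n
    induction n with
    | zero => simpa using he
    | succ n ih =>
      rw [← htake, ← htake] at ih
      have h := hinj (subword_mem_wordsOfLength hx _ _) (subword_mem_wordsOfLength hx' _ _) ih
      rw [subword_eq_iff] at h ⊢
      intro k hk
      have := h (k + 1) (by omega)
      push_cast at this ⊢
      convert this using 2 <;> ring
  have h := subword_eq_iff.1 (hpair (i + L).toNat) 0 (by omega)
  rw [Int.toNat_of_nonneg (by omega)] at h
  simpa using h

end Complexity

/-! ### Finiteness of the fibres. -/

section Fibers

variable {A : Type*} [Finite A] {p : ℕ} [NeZero p]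

/-- The blocks of order `k` around the origin: for each `z`, two consecutive blocks, at the
positions `e` and `e + 1` for a fixed `e`, cover arbitrarily large windows. -/
theorem exists_two_blocks_cover (hp : 2 ≤ p) (z : odometer p) :
    ∃ e : ℤ, ∀ L : ℕ, ∃ k : ℕ, ∀ i : ℤ, i.natAbs ≤ L →
      (i + (z.1 k).val) / (p : ℤ) ^ k = e ∨ (i + (z.1 k).val) / (p : ℤ) ^ k = e + 1 := by
  have hpos : ∀ k : ℕ, (0 : ℤ) < (p : ℤ) ^ k := fun k => by positivity
  have hlt : ∀ k : ℕ, ((z.1 k).val : ℤ) < (p : ℤ) ^ k := fun k => by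
    exact_mod_cast ZMod.val_lt (z.1 k)
  have hk : ∀ k : ℕ, (k : ℤ) < (p : ℤ) ^ k := fun k => by
    exact_mod_cast Nat.lt_pow_self (by omega : 1 < p)
  have quot : ∀ (a b q : ℤ), 0 < b → q * b ≤ a → a < (q + 1) * b → a / b = q := by
    intro a b q hb h1 h2
    have h3 := (Int.le_ediv_iff_mul_le hb).2 h1
    have h4 := (Int.ediv_lt_iff_lt_mul hb).2 h2
    omega
  -- Blocks of order `k` begin at `-(z.1 k).val` modulo `p ^ k`. If these residues stay bounded,
  -- only that boundary can enter the window; otherwise it leaves to the left and only the next one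
  -- can.
  by_cases hbdd : ∃ B : ℕ, ∀ k, (z.1 k).val ≤ B
  · obtain ⟨B, hB⟩ := hbdd
    refine ⟨-1, fun L => ⟨L + B, fun i hi => ?_⟩⟩
    have h1 := hk (L + B)
    have h2 := hB (L + B)
    push_cast at h1
    rcases lt_or_ge (i + ((z.1 (L + B)).val : ℤ)) 0 with h | h
    · left; apply quot _ _ _ (hpos _) <;> omega
    · right; apply quot _ _ _ (hpos _) <;> omega
  · push Not at hbdd
    have hmono : Monotone fun k => (z.1 k).val := monotone_nat_of_le_succ fun k => by
      rw [← val_odometer_succ_mod z k]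
      exact Nat.mod_le _ _
    refine ⟨0, fun L => ?_⟩
    obtain ⟨k, hkL⟩ := hbdd L
    refine ⟨L + k, fun i hi => ?_⟩
    have h1 := hk (L + k)
    have h2 : (z.1 k).val ≤ (z.1 (L + k)).val := hmono (by omega)
    have h3 := hlt (L + k)
    push_cast at h1
    rcases lt_or_ge (i + ((z.1 (L + k)).val : ℤ)) ((p : ℤ) ^ (L + k)) with h | h
    · left; apply quot _ _ _ (hpos _) <;> omega
    · right; apply quot _ _ _ (hpos _) <;> omega

/-- All points of the fibre have the same block boundaries of order `k`, so on a window covered by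
two blocks a point is determined by two adjacent letters of its desubstitution. -/
theorem finite_fiber_toOdometer {τ : A → Fin p → A} (hp : 2 ≤ p) (hprim : IsPrimitive τ)
    (hinf : (subshift τ).Infinite) (z : odometer p) :
    (toOdometer τ ⁻¹' {z}).Finite ∧
      (toOdometer τ ⁻¹' {z}).ncard ≤ (wordsOfLength τ 2).ncard := by
  obtain ⟨e, he⟩ := exists_two_blocks_cover hp z
  have h := finite_of_separating (S := Subtype.val '' (toOdometer τ ⁻¹' {z}))
    (finite_wordsOfLength τ 2) fun L => by
      obtain ⟨k, hk⟩ := he L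
      have hex : ∀ x : ℤ → A, ∃ y : ℤ → A, x ∈ Subtype.val '' (toOdometer τ ⁻¹' {z}) →
          y ∈ subshift τ ∧ x = shiftBy ((z.1 k).val : ℤ) ((onSeq τ)^[k] y) := by
        intro x
        by_cases hx : x ∈ Subtype.val '' (toOdometer τ ⁻¹' {z})
        · obtain ⟨x, hxz, rfl⟩ := hx
          obtain ⟨y, hy, hyx⟩ := mem_level_of_toOdometer_apply hp hprim hinf (x := x) (k := k)
            (n := ((z.1 k).val : ℤ)) (by rw [show toOdometer τ x = z from hxz]; simp)
          exact ⟨y, fun _ => ⟨hy, hyx.symm⟩⟩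
        · exact ⟨x, fun h => absurd h hx⟩
      choose y hy using hex
      refine ⟨fun x => subword (y x) e 2,
        fun x hx => subword_mem_wordsOfLength (hy x hx).1 _ _, fun x hx x' hx' hw i hi => ?_⟩
      rw [subword_eq_iff] at hw
      rw [(hy x hx).2, (hy x' hx').2]
      apply iterate_onSeq_congr
      rcases hk i hi with h | h <;> rw [h]
      · simpa using hw 0 (by omega)
      · simpa using hw 1 (by omega)
  rwa [Set.finite_image_iff Subtype.val_injective.injOn,
    Set.ncard_image_of_injective _ Subtype.val_injective] at h

end Fibers

/-! ### Li–Yorke pairs and scrambled sets. -/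

section LiYorke

/-- A factor map onto an odometer identifies the points of a Li–Yorke pair. -/
theorem IsLiYorkePair.eq_of_semiconj {X : Type*} [MetricSpace X] [CompactSpace X] {T : X → X}
    {p : ℕ} [NeZero p] {π : X → odometer p} (hπ : Continuous π) (hT : ∀ x, π (T x) = addOne p (π x))
    {x y : X} (h : IsLiYorkePair T x y) : π x = π y := by
  have hiter : ∀ (n : ℕ) (x : X), π (T^[n] x) = π x + n := by
    intro n x
    induction n with
    | zero => simp
    | succ n ih =>
      rw [Function.iterate_succ_apply', hT, ih, addOne, Nat.cast_succ, add_assoc]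
  refine Subtype.ext (funext fun k => ?_)
  have hc : Continuous fun x => (((π x).1 k).val : ℝ) :=
    (continuous_of_discreteTopology (f := fun v : ZMod (p ^ k) => (v.val : ℝ))).comp
      ((continuous_apply k).comp (continuous_subtype_val.comp hπ))
  obtain ⟨ε, hε, hclose⟩ :=
    Metric.uniformContinuous_iff.1 (CompactSpace.uniformContinuous_of_continuous hc) 1 one_pos
  -- The real `liminf` yields small distances only under a boundedness condition; here the diameter
  -- is a bound.
  have hcobdd : IsCoboundedUnder (· ≥ ·) atTop fun n : ℕ => dist (T^[n] x) (T^[n] y) :=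
    IsBoundedUnder.isCoboundedUnder_ge (isBoundedUnder_of
      ⟨Metric.diam (Set.univ : Set X), fun n => Metric.dist_le_diam_of_mem isCompact_univ.isBounded
        (Set.mem_univ _) (Set.mem_univ _)⟩)
  obtain ⟨n, hn⟩ := (frequently_lt_of_liminf_lt hcobdd (h.2.trans_lt hε)).exists
  have hd := hclose hn
  rw [Nat.dist_cast_real, Nat.dist_eq] at hd
  have hval : ((π (T^[n] x)).1 k).val = ((π (T^[n] y)).1 k).val := by
    have : |(((π (T^[n] x)).1 k).val : ℤ) - ((π (T^[n] y)).1 k).val| < 1 := by exact_mod_cast hd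
    rw [Int.abs_lt_one_iff] at this
    omega
  -- The coordinates agree at time `n`, and both have been translated by `n` since time 0.
  have heq := ZMod.val_injective _ hval
  rw [hiter, hiter] at heq
  exact add_right_cancel (b := ((n : odometer p).1 k)) heq

/-- Scrambled sets of a primitive aperiodic substitution subshift are finite, for any metric that
induces its topology. -/
theorem finite_of_isScrambled {A : Type*} [Finite A] [TopologicalSpace A] [DiscreteTopology A]
    {p : ℕ} [NeZero p] {τ : A → Fin p → A} (hp : 2 ≤ p) (hprim : IsPrimitive τ)
    (hinf : (subshift τ).Infinite) (ϱ : MetricSpace (subshift τ))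
    (hϱ : ϱ.toPseudoMetricSpace.toUniformSpace.toTopologicalSpace =
      (instTopologicalSpaceSubtype : TopologicalSpace (subshift τ)))
    {S : Set (subshift τ)} (hS : @IsScrambled _ ϱ (shift τ) S) : S.Finite := by
  -- Compactness and continuity are carried over to the topology of `ϱ` through `hϱ`.
  have hcomp : @CompactSpace _ ϱ.toPseudoMetricSpace.toUniformSpace.toTopologicalSpace := by
    rw [hϱ]
    exact isCompact_iff_compactSpace.1 (isClosed_subshift τ).isCompact
  have hcont : @Continuous _ _ ϱ.toPseudoMetricSpace.toUniformSpace.toTopologicalSpace _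
      (toOdometer τ) := by
    rw [hϱ]
    exact continuous_toOdometer hp hprim hinf
  rcases S.eq_empty_or_nonempty with rfl | ⟨x, hx⟩
  · exact Set.finite_empty
  refine (finite_fiber_toOdometer hp hprim hinf (toOdometer τ x)).1.subset fun y hy => ?_
  by_cases hxy : y = x
  · rw [hxy]; rfl
  · exact @IsLiYorkePair.eq_of_semiconj _ ϱ hcomp _ _ _ _ hcont (toOdometer_shift hp hprim hinf)
      _ _ (hS y hy x hx hxy)

end LiYorke

end ConstLength

/-- Two-sided sequences carry the product of the discrete topologies on the alphabet `A`. The last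
part holds for every metric that induces the topology of `X_τ`. -/
theorem lemma2p7 {A : Type*} [Finite A] [TopologicalSpace A] [DiscreteTopology A]
    {p : ℕ} [NeZero p] (hp : 2 ≤ p) (τ : A → Fin p → A)
    (hprim : ConstLength.IsPrimitive τ) (hinf : (ConstLength.subshift τ).Infinite) :
    (∀ x : ConstLength.subshift τ,
      ∃! q : (ℕ → ConstLength.subshift τ) × (ℕ → Fin p),
        ConstLength.Desubstitutes τ x q.1 q.2) ∧
    ConstLength.IsFactorMap (ConstLength.shift τ) (ConstLength.addOne p)
      (ConstLength.toOdometer τ) ∧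
    (∀ z : ConstLength.odometer p,
      (ConstLength.toOdometer τ ⁻¹' {z}).Finite ∧
      (ConstLength.toOdometer τ ⁻¹' {z}).ncard < (ConstLength.wordsOfLength τ 3).ncard) ∧
    (∀ ϱ : MetricSpace (ConstLength.subshift τ),
      ϱ.toPseudoMetricSpace.toUniformSpace.toTopologicalSpace =
        (instTopologicalSpaceSubtype : TopologicalSpace (ConstLength.subshift τ)) →
      ∀ S : Set (ConstLength.subshift τ),
        @ConstLength.IsScrambled _ ϱ (ConstLength.shift τ) S → S.Finite) := by
  refine ⟨fun x => ConstLength.existsUnique_desubstitutes hp hprim hinf x,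
    ⟨ConstLength.continuous_toOdometer hp hprim hinf,
      ConstLength.surjective_toOdometer hp hprim hinf,
      ConstLength.toOdometer_shift hp hprim hinf⟩, fun z => ?_,
    fun ϱ hϱ S hS => ConstLength.finite_of_isScrambled hp hprim hinf ϱ hϱ hS⟩
  obtain ⟨hfin, hcard⟩ := ConstLength.finite_fiber_toOdometer hp hprim hinf z
  exact ⟨hfin, hcard.trans_lt (ConstLength.ncard_wordsOfLength_two_lt_three hinf)⟩
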